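/- Let $\mathbb{T} = \{z \in \mathbb{C} : |z| = 1\}$. For a closed set $E \subseteq \mathbb{T}$ and an integer $k$ let $$\hat{E}(k) = \frac{1}{2\pi} \int_E e^{-ikt}\, dt = \frac{1}{2\pi} \int_{\{t \in (0, 2\pi] \,:\, e^{it} \in E\}} e^{-ikt}\, dt$$ be the $k$th Fourier coefficient of the characteristic function of $E$. An arc is a closed, connected, proper subset of $\mathbb{T}$ with more than one point. A union of at most $n$ arcs is a union of $m$ arcs, not necessarily disjoint, for some integer $m$ with $0 \le m \le n$; the empty set and, by convention, the whole circle $\mathbb{T}$ are unions of $0$ arcs. Let $n$ be a nonnegative integer, and let $E_1$ and $E_2$ be unions of at most $n$ arcs such that $$\hat{E}_1(k) = \hat{E}_2(k) \quad \text{for all integers } k \text{ with } 0 \le k \le n.$$ Then $E_1 = E_2$. -/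

import Mathlib

noncomputable section

/-- A (nondegenerate) arc: a closed, connected (in particular nonempty), proper subset of the
unit circle with more than one point. -/
def IsArc (A : Set Circle) : Prop :=
  IsClosed A ∧ IsConnected A ∧ A ≠ Set.univ ∧ A.Nontrivial

/-- `E` is a union of `m` arcs, not necessarily disjoint, for some `m ≤ n`. The empty set is the
union of `0` arcs, and the whole circle is by convention a union of `0` arcs as well. -/
def IsUnionOfAtMostArcs (n : ℕ) (E : Set Circle) : Prop :=
  E = Set.univ ∨ ∃ m : ℕ, m ≤ n ∧ ∃ A : Fin m → Set Circle, (∀ i, IsArc (A i)) ∧ E = ⋃ i, A i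

/-- The `k`th Fourier coefficient `(1 / 2π) ∫_E e^{-ikt} dt` of the characteristic function
of `E`, where `E` is parametrized by `t ↦ e^{it}`, `0 < t ≤ 2π`. -/
def arcFourierCoeff (E : Set Circle) (k : ℤ) : ℂ :=
  (1 / (2 * Real.pi) : ℂ) *
    ∫ t in {t : ℝ | t ∈ Set.Ioc 0 (2 * Real.pi) ∧ Circle.exp t ∈ E},
      Complex.exp (-(Complex.I * (k : ℂ) * (t : ℂ)))

end

open MeasureTheory Set Polynomial

/-! A union `E` of at most `n` arcs has the sign pattern of a real trigonometric polynomial `q` of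
degree at most `n`: nonnegative on `E`, nonpositive off it
(`IsUnionOfAtMostArcs.exists_isTrigPoly`). Conjugation extends agreement of the coefficients to `|k|
≤ n`, so `q` has equal integrals over `E` and `F`, hence over `E \ F` and `F \ E`. The first is
nonnegative and the second nonpositive, so both vanish. As `q` has finitely many zeros, both
differences are null (`measure_diff_eq_zero`). Both sets are closed and lie in the closure of their
interior, so they coincide. -/

noncomputable instance : MeasurableSpace Circle := borel Circle

instance : BorelSpace Circle := ⟨rfl⟩

theorem continuous_coe_zpow (k : ℤ) : Continuous fun z : Circle => (z : ℂ) ^ k :=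
  (by fun_prop : Continuous fun z : Circle => (z : ℂ)).zpow₀ _ fun z => Or.inl z.coe_ne_zero

/-- Arc length on the circle, transported from `(0, 2π]` by `t ↦ e^{it}`. -/
noncomputable def arcLength : Measure Circle :=
  (volume.restrict (Ioc 0 (2 * Real.pi))).map Circle.exp

instance : IsFiniteMeasure arcLength := by
  unfold arcLength; infer_instance

instance : NullSingletonClass arcLength where
  measure_singleton z := by
    rw [arcLength, Measure.map_apply (Circle.exp.continuous.measurable)
      (measurableSet_singleton z), Measure.restrict_apply
      (Circle.exp.continuous.measurable (measurableSet_singleton z))]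
    refine Set.Subsingleton.measure_zero ?_ _
    rintro x ⟨hx, hx'⟩ y ⟨hy, hy'⟩
    exact Circle.exp_injOn_Ioc (by linarith) hx' hy' (hx.trans hy.symm)

theorem arcLength_pos_of_isOpen {U : Set Circle} (hU : IsOpen U) (hne : U.Nonempty) :
    arcLength U ≠ 0 := by
  rw [arcLength, Measure.map_apply (Circle.exp.continuous.measurable) hU.measurableSet,
    Measure.restrict_apply (Circle.exp.continuous.measurable hU.measurableSet)]
  have hV : IsOpen (Circle.exp ⁻¹' U) := hU.preimage Circle.exp.continuous
  have hpi := Real.two_pi_pos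
  obtain ⟨z, hz⟩ := hne
  obtain ⟨t, ht, htz⟩ : ∃ t ∈ Ioc 0 (2 * Real.pi), Circle.exp t = z := by
    obtain ⟨t, ht, h⟩ := Circle.periodic_exp.exists_mem_Ioc hpi (Complex.arg z) 0
    exact ⟨t, by simpa using ht, by rw [← h, Circle.exp_arg]⟩
  -- `t` may be the endpoint `2π`, so it is only a limit of interior parameters.
  have hcl : t ∈ closure (Ioo 0 (2 * Real.pi)) := by
    rw [closure_Ioo hpi.ne]; exact Ioc_subset_Icc_self ht
  have hmem : t ∈ Circle.exp ⁻¹' U := by simpa [htz] using hz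
  have h := mem_closure_iff.1 hcl _ hV hmem
  refine ((hV.inter isOpen_Ioo).measure_pos volume h).ne' ∘ fun h0 => ?_
  exact measure_mono_null (inter_subset_inter_right _ Ioo_subset_Ioc_self) h0

theorem arcFourierCoeff_eq {E : Set Circle} (hE : MeasurableSet E) (k : ℤ) :
    arcFourierCoeff E k =
      (1 / (2 * Real.pi) : ℂ) * ∫ z in E, (z : ℂ) ^ (-k) ∂arcLength := by
  have hm := Circle.exp.continuous.measurable
  have hc := continuous_coe_zpow (-k)
  rw [arcFourierCoeff, arcLength, Measure.restrict_map hm hE,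
    integral_map hm.aemeasurable hc.aestronglyMeasurable, Measure.restrict_restrict (hm hE)]
  congr 2
  · congr 1
    ext t; simp [and_comm]
  · ext t
    rw [Circle.coe_exp, ← Complex.exp_int_mul]
    congr 1
    push_cast
    ring

/-! ### Arcs -/

theorem IsArc.exists_eq_image {A : Set Circle} (hA : IsArc A) :
    ∃ a b : ℝ, a < b ∧ b < a + 2 * Real.pi ∧ A = Circle.exp '' Icc a b := by
  obtain ⟨hcl, hconn, hne, hnt⟩ := hA
  obtain ⟨w, hw⟩ := (Set.ne_univ_iff_exists_notMem A).1 hne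
  -- `r = -w`: dividing by `r` moves the omitted point `w` to `-1`, onto the branch cut of `arg`, so
  -- `g` is continuous on `A`.
  let r : Circle := Circle.exp (Complex.arg w + Real.pi)
  let g : Circle → ℝ := fun z => Complex.arg ((z * r⁻¹ : Circle) : ℂ)
  have hg : ∀ z, Circle.exp (g z + (Complex.arg w + Real.pi)) = z := fun z => by
    rw [Circle.exp_add, Circle.exp_arg, inv_mul_cancel_right]
  have hlt : ∀ z ∈ A, g z < Real.pi := fun z hz => by
    refine lt_of_le_of_ne (Complex.arg_le_pi _) fun h => hw ?_
    have := hg z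
    rw [h, show Real.pi + (Complex.arg w + Real.pi) = Complex.arg w + 2 * Real.pi by ring,
      Circle.exp_add_two_pi, Circle.exp_arg] at this
    rwa [this]
  have hcont : ContinuousOn g A := fun z hz => by
    have h1 : ContinuousAt Complex.arg ((z * r⁻¹ : Circle) : ℂ) :=
      Complex.continuousAt_arg (Complex.mem_slitPlane_iff_arg.2
        ⟨(hlt z hz).ne, Circle.coe_ne_zero _⟩)
    have h2 : Continuous fun z : Circle => ((z * r⁻¹ : Circle) : ℂ) := by fun_prop
    exact (ContinuousAt.comp (f := fun z : Circle => ((z * r⁻¹ : Circle) : ℂ)) h1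
      h2.continuousAt).continuousWithinAt
  have hI := eq_Icc_of_connected_compact (hconn.image g hcont)
    (hcl.isCompact.image_of_continuousOn hcont)
  set a := sInf (g '' A)
  set b := sSup (g '' A)
  have hab : a < b := by
    obtain ⟨x, hx, y, hy, hxy⟩ := hnt
    have hx' : g x ∈ Icc a b := hI ▸ mem_image_of_mem g hx
    have hy' : g y ∈ Icc a b := hI ▸ mem_image_of_mem g hy
    rcases lt_trichotomy (g x) (g y) with h | h | h
    · exact hx'.1.trans_lt (h.trans_le hy'.2)
    · exact (hxy (by rw [← hg x, h, hg y])).elim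
    · exact hy'.1.trans_lt (h.trans_le hx'.2)
  have ha : -Real.pi < a := by
    obtain ⟨z, hz, h⟩ : a ∈ g '' A := hI ▸ left_mem_Icc.2 hab.le
    rw [← h]; exact Complex.neg_pi_lt_arg _
  have hb : b < Real.pi := by
    obtain ⟨z, hz, h⟩ : b ∈ g '' A := hI ▸ right_mem_Icc.2 hab.le
    rw [← h]; exact hlt z hz
  refine ⟨a + (Complex.arg w + Real.pi), b + (Complex.arg w + Real.pi), by linarith,
    by linarith, ?_⟩
  rw [← image_add_const_Icc, ← hI, image_image, image_image]
  simp [hg]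

/-- With `c` the midpoint and `ρ` the cosine of half the length, this says that the angular distance
to `c` is at most half the length, since cosine decreases on `[0, π]`. -/
theorem IsArc.exists_cos {A : Set Circle} (hA : IsArc A) :
    ∃ c ρ : ℝ, ∀ t, Circle.exp t ∈ A ↔ ρ ≤ Real.cos (t - c) := by
  obtain ⟨a, b, hab, hba, rfl⟩ := hA.exists_eq_image
  refine ⟨(a + b) / 2, Real.cos ((b - a) / 2), fun t => ⟨?_, fun h => ?_⟩⟩
  · rintro ⟨s, ⟨hs, hs'⟩, hst⟩
    obtain ⟨m, hm⟩ := Circle.exp_eq_exp.1 hst.symm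
    rw [hm, show s + m * (2 * Real.pi) - (a + b) / 2 = s - (a + b) / 2 + m * (2 * Real.pi) by ring,
      Real.cos_add_int_mul_two_pi, ← Real.cos_abs (s - _)]
    apply Real.cos_le_cos_of_nonneg_of_le_pi (abs_nonneg _) (by linarith)
    rw [abs_le]; constructor <;> linarith
  · obtain ⟨s, hs, hst⟩ := Circle.periodic_exp.exists_mem_Ioc Real.two_pi_pos t
      ((a + b) / 2 - Real.pi)
    obtain ⟨m, hm⟩ := Circle.exp_eq_exp.1 hst
    rw [hm, show s + m * (2 * Real.pi) - (a + b) / 2 = s - (a + b) / 2 + m * (2 * Real.pi) by ring,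
      Real.cos_add_int_mul_two_pi, ← Real.cos_abs (s - _)] at h
    have h1 : |s - (a + b) / 2| ≤ Real.pi := by
      rw [abs_le]; constructor <;> linarith [hs.1, hs.2]
    have h2 := (Real.strictAntiOn_cos.le_iff_ge
      (⟨by linarith, by linarith⟩ : (b - a) / 2 ∈ Icc 0 Real.pi) ⟨abs_nonneg _, h1⟩).1 h
    rw [abs_le] at h2
    exact ⟨s, ⟨by linarith, by linarith⟩, hst.symm⟩

theorem IsArc.subset_closure_interior {A : Set Circle} (hA : IsArc A) :
    A ⊆ closure (interior A) := by
  obtain ⟨a, b, hab, -, rfl⟩ := hA.exists_eq_image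
  have h : Circle.exp '' Ioo a b ⊆ interior (Circle.exp '' Icc a b) :=
    interior_maximal (image_mono Ioo_subset_Icc_self)
      (isLocalHomeomorph_circleExp.isOpenMap _ isOpen_Ioo)
  rw [← closure_Ioo hab.ne]
  refine (image_closure_subset_closure_image Circle.exp.continuous).trans (closure_mono ?_)
  rwa [closure_Ioo hab.ne]

theorem IsArc.union {A B : Set Circle} (hA : IsArc A) (hB : IsArc B) (h : (A ∩ B).Nonempty)
    (hne : A ∪ B ≠ univ) : IsArc (A ∪ B) :=
  ⟨hA.1.union hB.1, hA.2.1.union h hB.2.1, hne, hA.2.2.2.mono subset_union_left⟩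

theorem IsUnionOfAtMostArcs.isClosed {n : ℕ} {E : Set Circle} (hE : IsUnionOfAtMostArcs n E) :
    IsClosed E := by
  obtain rfl | ⟨m, -, A, hA, rfl⟩ := hE
  · exact isClosed_univ
  · exact isClosed_iUnion_of_finite fun i => (hA i).1

theorem IsUnionOfAtMostArcs.subset_closure_interior {n : ℕ} {E : Set Circle}
    (hE : IsUnionOfAtMostArcs n E) : E ⊆ closure (interior E) := by
  obtain rfl | ⟨m, -, A, hA, rfl⟩ := hE
  · simp
  · exact iUnion_subset fun i => (hA i).subset_closure_interior.trans
      (closure_mono (interior_mono (subset_iUnion A i)))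

/-- A union of at most `n` arcs, if not the whole circle, is a disjoint union of at most `n`
arcs. -/
theorem IsUnionOfAtMostArcs.exists_finset {n : ℕ} {E : Set Circle}
    (hE : IsUnionOfAtMostArcs n E) (hne : E ≠ univ) :
    ∃ S : Finset (Set Circle), S.card ≤ n ∧ (∀ A ∈ S, IsArc A) ∧
      (S : Set (Set Circle)).PairwiseDisjoint id ∧ E = ⋃ A ∈ S, A := by
  classical
  let P : ℕ → Prop := fun m => ∃ S : Finset (Set Circle), S.card = m ∧ (∀ A ∈ S, IsArc A) ∧
    E = ⋃ A ∈ S, A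
  obtain ⟨m, hm, hP⟩ : ∃ m ≤ n, P m := by
    obtain h | ⟨m, hm, A, hA, rfl⟩ := hE
    · exact (hne h).elim
    · refine ⟨(Finset.univ.image A).card, (Finset.card_image_le.trans (by simp)).trans hm,
        _, rfl, by simpa using hA, by simp⟩
  have hex : ∃ m, P m := ⟨m, hP⟩
  -- A family with the fewest arcs is disjoint: two arcs that meet could be merged into one, their
  -- union being proper because `E` is.
  obtain ⟨S, hS, hArc, hEq⟩ := Nat.find_spec hex
  refine ⟨S, hS ▸ (Nat.find_min' hex hP).trans hm, hArc, ?_, hEq⟩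
  intro A hA B hB hAB
  by_contra hdis
  have hint : (A ∩ B).Nonempty := not_disjoint_iff_nonempty_inter.1 hdis
  have hBA : B ∈ S.erase A := Finset.mem_erase.2 ⟨hAB.symm, hB⟩
  have hSeq : S = insert A (insert B ((S.erase A).erase B)) := by
    rw [Finset.insert_erase hBA, Finset.insert_erase hA]
  have hEq' : E = ⋃ C ∈ insert (A ∪ B) ((S.erase A).erase B), C := by
    rw [hEq]
    conv_lhs => rw [hSeq]
    simp only [Finset.set_biUnion_insert, union_assoc]
  have hsub : A ∪ B ⊆ E := by rw [hEq']; simp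
  have hcard : (insert (A ∪ B) ((S.erase A).erase B)).card < S.card := by
    have h1 := Finset.card_insert_le (A ∪ B) ((S.erase A).erase B)
    have h2 := Finset.card_erase_add_one hBA
    have h3 := Finset.card_erase_add_one hA
    omega
  refine Nat.find_min hex (hS ▸ hcard) ⟨_, rfl, fun C hC => ?_, hEq'⟩
  rcases Finset.mem_insert.1 hC with rfl | hC
  · exact (hArc A hA).union (hArc B hB) hint fun h => hne (univ_subset_iff.1 (h ▸ hsub))
  · exact hArc C (Finset.mem_of_mem_erase (Finset.mem_of_mem_erase hC))

/-! ### Trigonometric polynomials -/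

/-- `q` is a nonzero real trigonometric polynomial of degree at most `n` on the circle. -/
def IsTrigPoly (n : ℕ) (q : Circle → ℝ) : Prop :=
  ∃ P : ℂ[X], P ≠ 0 ∧ P.natDegree ≤ 2 * n ∧ ∀ z : Circle, (q z : ℂ) * (z : ℂ) ^ n = P.eval (z : ℂ)

theorem IsTrigPoly.one : IsTrigPoly 0 fun _ => 1 := ⟨1, by simp⟩

theorem IsTrigPoly.neg {n : ℕ} {q : Circle → ℝ} (hq : IsTrigPoly n q) :
    IsTrigPoly n fun z => -q z := by
  obtain ⟨P, h0, hd, h⟩ := hq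
  exact ⟨-P, by simpa, by simpa, fun z => by simp [← h]⟩

theorem IsTrigPoly.mul {m n : ℕ} {p q : Circle → ℝ} (hp : IsTrigPoly m p) (hq : IsTrigPoly n q) :
    IsTrigPoly (m + n) fun z => p z * q z := by
  obtain ⟨P, hP0, hPd, hP⟩ := hp
  obtain ⟨Q, hQ0, hQd, hQ⟩ := hq
  refine ⟨P * Q, mul_ne_zero hP0 hQ0, natDegree_mul_le.trans (by omega), fun z => ?_⟩
  rw [eval_mul, ← hP, ← hQ]
  push_cast
  ring

theorem IsTrigPoly.mono {m n : ℕ} {q : Circle → ℝ} (hq : IsTrigPoly m q) (h : m ≤ n) :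
    IsTrigPoly n q := by
  obtain ⟨P, hP0, hPd, hP⟩ := hq
  refine ⟨P * X ^ (n - m), mul_ne_zero hP0 (pow_ne_zero _ X_ne_zero), ?_, fun z => ?_⟩
  · refine natDegree_mul_le.trans ?_
    rw [natDegree_X_pow]; omega
  · rw [eval_mul, ← hP, eval_pow, eval_X, mul_assoc, ← pow_add, Nat.add_sub_cancel' h]

theorem IsTrigPoly.finite_zeros {n : ℕ} {q : Circle → ℝ} (hq : IsTrigPoly n q) :
    {z | q z = 0}.Finite := by
  obtain ⟨P, hP0, -, hP⟩ := hq
  refine Set.Finite.of_finite_image (f := ((↑) : Circle → ℂ))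
    ((P.finite_setOfPred_isRoot hP0).subset ?_) Circle.coe_injective.injOn
  rintro _ ⟨z, hz, rfl⟩
  have := hP z
  rw [show q z = 0 from hz] at this
  simpa using this.symm

theorem IsTrigPoly.eq_sum {n : ℕ} {q : Circle → ℝ} (hq : IsTrigPoly n q) :
    ∃ a : ℕ → ℂ, ∀ z : Circle,
      (q z : ℂ) = ∑ k ∈ Finset.range (2 * n + 1), a k * (z : ℂ) ^ ((k : ℤ) - n) := by
  obtain ⟨P, -, hd, hP⟩ := hq
  refine ⟨P.coeff, fun z => ?_⟩
  have hz := z.coe_ne_zero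
  apply mul_right_cancel₀ (pow_ne_zero n hz)
  rw [hP, eval_eq_sum_range' (Nat.lt_succ_of_le hd), Finset.sum_mul]
  refine Finset.sum_congr rfl fun k _ => ?_
  rw [mul_assoc, ← zpow_natCast (z : ℂ) n, ← zpow_add₀ hz, sub_add_cancel, zpow_natCast]

theorem IsTrigPoly.continuous {n : ℕ} {q : Circle → ℝ} (hq : IsTrigPoly n q) : Continuous q := by
  obtain ⟨a, ha⟩ := hq.eq_sum
  have h : q = fun z : Circle =>
      (∑ k ∈ Finset.range (2 * n + 1), a k * (z : ℂ) ^ ((k : ℤ) - n)).re := by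
    funext z; rw [← ha, Complex.ofReal_re]
  rw [h]
  exact Complex.continuous_re.comp (continuous_finsetSum _ fun k _ => continuous_const.mul
    (continuous_coe_zpow _))

/-- Multiplication by `z = e^{iθ}` turns `ρ - cos (θ - c)` into a quadratic whose constant term
`-e^{ic}/2` is nonzero. -/
theorem isTrigPoly_sub_cos (ρ c : ℝ) :
    IsTrigPoly 1 fun z => ρ - Real.cos (Complex.arg z - c) := by
  refine ⟨C (-(Complex.exp (-(c * Complex.I)) / 2)) * X ^ 2 + C (ρ : ℂ) * X +
    C (-(Complex.exp (c * Complex.I) / 2)), fun h => ?_, natDegree_quadratic_le, fun z => ?_⟩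
  · have := congrArg (fun p => coeff p 0) h
    simp [Complex.exp_ne_zero] at this
  · have hz : (z : ℂ) = Complex.exp (Complex.arg z * Complex.I) := by
      conv_lhs => rw [← Circle.exp_arg z, Circle.coe_exp]
    have hz1 : Complex.exp (-(Complex.arg z * Complex.I)) * z = 1 := by
      rw [hz, ← Complex.exp_add]; simp [← hz]
    simp only [eval_add, eval_mul, eval_C, eval_pow, eval_X]
    push_cast
    rw [Complex.cos, pow_one, neg_sub,
      show (Complex.arg z - c) * Complex.I = Complex.arg z * Complex.I + -(c * Complex.I) by ring,
      show (c - Complex.arg z) * Complex.I = c * Complex.I + -(Complex.arg z * Complex.I) by ring,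
      Complex.exp_add, Complex.exp_add, ← hz]
    linear_combination (-Complex.exp (c * Complex.I) / 2) * hz1

theorem IsArc.exists_isTrigPoly {A : Set Circle} (hA : IsArc A) :
    ∃ q, IsTrigPoly 1 q ∧ ∀ z, z ∈ A ↔ q z ≤ 0 := by
  obtain ⟨c, ρ, h⟩ := hA.exists_cos
  refine ⟨_, isTrigPoly_sub_cos ρ c, fun z => ?_⟩
  rw [sub_nonpos, ← h, Circle.exp_arg]

/-- The product has one factor per arc, nonpositive exactly on that arc. By disjointness at most one
factor is nonpositive at any point. -/
theorem exists_isTrigPoly_of_pairwiseDisjoint (S : Finset (Set Circle)) (hS : ∀ A ∈ S, IsArc A)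
    (hd : (S : Set (Set Circle)).PairwiseDisjoint id) :
    ∃ q, IsTrigPoly S.card q ∧ (∀ z ∈ ⋃ A ∈ S, A, q z ≤ 0) ∧ ∀ z ∉ ⋃ A ∈ S, A, 0 ≤ q z := by
  classical
  induction S using Finset.induction_on with
  | empty => exact ⟨_, IsTrigPoly.one, by simp, by simp⟩
  | insert A S hAS ih =>
    obtain ⟨q, hq, hneg, hpos⟩ := ih (fun B hB => hS B (Finset.mem_insert_of_mem hB))
      (hd.subset (by simp))
    obtain ⟨p, hp, hpA⟩ := (hS A (Finset.mem_insert_self _ _)).exists_isTrigPoly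
    have hdis : Disjoint A (⋃ B ∈ S, B) := by
      simp only [disjoint_iUnion_right]
      intro B hB
      exact hd (by simp) (by simp [hB]) (fun h => hAS (h ▸ hB))
    refine ⟨_, Finset.card_insert_of_notMem hAS ▸ hq.mul hp, fun z hz => ?_, fun z hz => ?_⟩
    · rw [Finset.set_biUnion_insert] at hz
      rcases hz with hz | hz
      · exact mul_nonpos_of_nonneg_of_nonpos (hpos z (disjoint_left.1 hdis hz)) ((hpA z).1 hz)
      · exact mul_nonpos_of_nonpos_of_nonneg (hneg z hz)
          (not_le.1 fun h => disjoint_left.1 hdis ((hpA z).2 h) hz).le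
    · rw [Finset.set_biUnion_insert, mem_union, not_or] at hz
      exact mul_nonneg (hpos z hz.2) (not_le.1 fun h => hz.1 ((hpA z).2 h)).le

/-- The sign pattern of a union of at most `n` arcs is that of a trigonometric polynomial of
degree at most `n`. -/
theorem IsUnionOfAtMostArcs.exists_isTrigPoly {n : ℕ} {E : Set Circle}
    (hE : IsUnionOfAtMostArcs n E) :
    ∃ q, IsTrigPoly n q ∧ (∀ z ∈ E, 0 ≤ q z) ∧ ∀ z ∉ E, q z ≤ 0 := by
  by_cases hne : E = univ
  · exact ⟨_, IsTrigPoly.one.mono n.zero_le, by simp, by simp [hne]⟩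
  · obtain ⟨S, hcard, hArc, hd, rfl⟩ := hE.exists_finset hne
    obtain ⟨q, hq, hneg, hpos⟩ := exists_isTrigPoly_of_pairwiseDisjoint S hArc hd
    exact ⟨_, (hq.mono hcard).neg, fun z hz => neg_nonneg.2 (hneg z hz),
      fun z hz => neg_nonpos.2 (hpos z hz)⟩

/-! ### Moments -/

theorem integrable_coe_zpow (k : ℤ) : Integrable (fun z : Circle => (z : ℂ) ^ k) arcLength := by
  exact Integrable.of_bound (continuous_coe_zpow k).aestronglyMeasurable 1
    (Filter.Eventually.of_forall fun z => by rw [norm_zpow, Circle.norm_coe, one_zpow])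

theorem setIntegral_zpow_eq {n : ℕ} {E F : Set Circle} (hE : MeasurableSet E)
    (hF : MeasurableSet F)
    (h : ∀ k : ℤ, 0 ≤ k → k ≤ (n : ℤ) → arcFourierCoeff E k = arcFourierCoeff F k)
    {k : ℤ} (hk : |k| ≤ n) :
    ∫ z in E, (z : ℂ) ^ k ∂arcLength = ∫ z in F, (z : ℂ) ^ k ∂arcLength := by
  have key : ∀ j : ℤ, 0 ≤ j → j ≤ (n : ℤ) →
      ∫ z in E, (z : ℂ) ^ (-j) ∂arcLength = ∫ z in F, (z : ℂ) ^ (-j) ∂arcLength := by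
    intro j hj hjn
    have := h j hj hjn
    rw [arcFourierCoeff_eq hE, arcFourierCoeff_eq hF] at this
    exact mul_left_cancel₀ (by simp [Real.pi_ne_zero]) this
  rw [abs_le] at hk
  rcases le_total k 0 with h0 | h0
  · simpa using key (-k) (by omega) (by omega)
  · have hconj : ∀ G : Set Circle, ∫ z in G, (z : ℂ) ^ k ∂arcLength =
        (starRingEnd ℂ) (∫ z in G, (z : ℂ) ^ (-k) ∂arcLength) := fun G => by
      rw [← integral_conj]
      simp [← Circle.coe_inv_eq_conj]
    rw [hconj, hconj, key k h0 hk.2]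

theorem IsTrigPoly.setIntegral_eq {n : ℕ} {q : Circle → ℝ} (hq : IsTrigPoly n q)
    {E F : Set Circle} (hE : MeasurableSet E) (hF : MeasurableSet F)
    (h : ∀ k : ℤ, 0 ≤ k → k ≤ (n : ℤ) → arcFourierCoeff E k = arcFourierCoeff F k) :
    ∫ z in E, q z ∂arcLength = ∫ z in F, q z ∂arcLength := by
  obtain ⟨a, ha⟩ := hq.eq_sum
  have hG : ∀ G : Set Circle, ((∫ z in G, q z ∂arcLength : ℝ) : ℂ) =
      ∑ k ∈ Finset.range (2 * n + 1), a k * ∫ z in G, (z : ℂ) ^ ((k : ℤ) - n) ∂arcLength := by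
    intro G
    rw [← integral_complex_ofReal]
    simp only [ha]
    rw [integral_finsetSum _ fun k _ => ((integrable_coe_zpow _).integrableOn.const_mul _)]
    simp only [integral_const_mul]
  apply Complex.ofReal_injective
  rw [hG, hG]
  refine Finset.sum_congr rfl fun k hk => ?_
  rw [setIntegral_zpow_eq hE hF h]
  have := Finset.mem_range.1 hk
  rw [abs_le]; constructor <;> omega

/-! ### From equal moments to equal sets -/

theorem IsTrigPoly.measure_eq_zero {n : ℕ} {q : Circle → ℝ} (hq : IsTrigPoly n q)
    {D : Set Circle} (hD : MeasurableSet D) (hnn : ∀ z ∈ D, 0 ≤ q z)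
    (h0 : ∫ z in D, q z ∂arcLength = 0) : arcLength D = 0 := by
  have hint : IntegrableOn q D arcLength := hq.continuous.integrable_of_hasCompactSupport
    (HasCompactSupport.of_compactSpace q) |>.integrableOn
  have hae := (setIntegral_eq_zero_iff_of_nonneg_ae
    ((ae_restrict_iff' hD).2 (Filter.Eventually.of_forall hnn)) hint).1 h0
  rw [Filter.EventuallyEq, ae_restrict_iff' hD] at hae
  have hz : ∀ᵐ z ∂arcLength, z ∉ {z | q z = 0} :=
    measure_eq_zero_iff_ae_notMem.1 (hq.finite_zeros.measure_zero _)
  rw [measure_eq_zero_iff_ae_notMem]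
  filter_upwards [hae, hz] with z h1 h2 h3 using h2 (h1 h3)

theorem measure_diff_eq_zero {n : ℕ} {E F : Set Circle} (hE : IsUnionOfAtMostArcs n E)
    (hF : MeasurableSet F)
    (h : ∀ k : ℤ, 0 ≤ k → k ≤ (n : ℤ) → arcFourierCoeff E k = arcFourierCoeff F k) :
    arcLength (E \ F) = 0 ∧ arcLength (F \ E) = 0 := by
  obtain ⟨q, hq, hpos, hneg⟩ := hE.exists_isTrigPoly
  have hEm := hE.isClosed.measurableSet
  have hint : Integrable q arcLength := hq.continuous.integrable_of_hasCompactSupport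
    (HasCompactSupport.of_compactSpace q)
  have heq := hq.setIntegral_eq hEm hF h
  -- The common part `E ∩ F` cancels, leaving the integrals over the two differences.
  rw [← integral_inter_add_sdiff hF hint.integrableOn,
    ← integral_inter_add_sdiff (s := F) hEm hint.integrableOn, inter_comm F E,
    add_right_inj] at heq
  have h1 : 0 ≤ ∫ z in E \ F, q z ∂arcLength :=
    setIntegral_nonneg (hEm.diff hF) fun z hz => hpos z hz.1
  have h2 : ∫ z in F \ E, q z ∂arcLength ≤ 0 :=
    setIntegral_nonpos (hF.diff hEm) fun z hz => hneg z hz.2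
  refine ⟨hq.measure_eq_zero (hEm.diff hF) (fun z hz => hpos z hz.1) (by linarith),
    hq.neg.measure_eq_zero (hF.diff hEm) (fun z hz => neg_nonneg.2 (hneg z hz.2)) ?_⟩
  rw [integral_neg]; linarith

/-- `interior E \ F` is open and null, hence empty; closedness of `F` then captures the closure. -/
theorem subset_of_measure_diff_eq_zero {E F : Set Circle} (hE : E ⊆ closure (interior E))
    (hF : IsClosed F) (h : arcLength (E \ F) = 0) : E ⊆ F := by
  refine hE.trans (closure_minimal (fun z hz => ?_) hF)
  by_contra hzF
  exact arcLength_pos_of_isOpen (isOpen_interior.inter hF.isOpen_compl) ⟨z, hz, hzF⟩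
    (measure_mono_null (sdiff_subset_sdiff_left interior_subset) h)

theorem theorem1 (n : ℕ) (E₁ E₂ : Set Circle)
    (hE₁ : IsUnionOfAtMostArcs n E₁) (hE₂ : IsUnionOfAtMostArcs n E₂)
    (h : ∀ k : ℤ, 0 ≤ k → k ≤ (n : ℤ) → arcFourierCoeff E₁ k = arcFourierCoeff E₂ k) :
    E₁ = E₂ := by
  obtain ⟨h₁, h₂⟩ := measure_diff_eq_zero hE₁ hE₂.isClosed.measurableSet h
  exact (subset_of_measure_diff_eq_zero hE₁.subset_closure_interior hE₂.isClosed h₁).antisymm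
    (subset_of_measure_diff_eq_zero hE₂.subset_closure_interior hE₁.isClosed h₂)
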